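/- For $n\times n$ complex matrices $A_1,\dots,A_k$ let $Q(X)=\sum_{i=1}^k A_iXA_i^*$ and let $Q'(X)=\sum_{i=1}^k A_i^*XA_i$ be its dual with respect to $\langle X,Y\rangle=\operatorname{tr}(XY^*)$. The operator $Q$ is called a quantum channel if $\sum_i A_i^*A_i=I_n$, and it is called positive if $Q(X)$ is positive definite for every positive semidefinite $X$ with $\operatorname{tr}X=1$. Let $Q$ be a positive quantum channel on $\mathbb C^{n\times n}$, and let $\rho_0,\rho_T\in\mathbb C^{n\times n}$ be positive definite matrices of trace $1$. Consider the system $$Q(\phi_T)=\phi_0,\quad Q'(\hat\phi_0)=\hat\phi_T,\quad \rho_0=\chi_0\hat\phi_0\chi_0^*,\quad \rho_T=\chi_T\hat\phi_T\chi_T^*,\quad \phi_0=\chi_0^*\chi_0,\quad \phi_T=\chi_T^*\chi_T \qquad (\ast)$$ with positive definite unknowns $\phi_0,\phi_T,\hat\phi_0,\hat\phi_T\in\mathbb C^{n\times n}$ and arbitrary (not necessarily Hermitian) unknowns $\chi_0,\chi_T\in\mathbb C^{n\times n}$. 1. There exist positive definite $\phi_0,\phi_T,\hat\phi_0,\hat\phi_T$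 and matrices $\chi_0,\chi_T$ satisfying $(\ast)$. 2. Conversely, every solution of $(\ast)$ yields a scaling of $Q$ to a quantum channel $R$ with $R(\rho_T)=\rho_0$: the matrices $\chi_0,\chi_T$ are invertible and, for the invertible matrices $S=\rho_0^{1/2}(\chi_0^*)^{-1}$ and $T=\chi_T^*\rho_T^{-1/2}$, the operator $R(X)=S\,Q(TXT^*)\,S^*$ is a quantum channel satisfying $R(\rho_T)=\rho_0$. -/

import Mathlib

open scoped Matrix ComplexOrder MatrixOrder

noncomputable section

namespace QuantumBridge

/-- The completely positive operator `X ↦ ∑ i, Aᵢ X Aᵢ*` on complex `n × n` matrices. -/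
def krausMap {n k : ℕ} (A : Fin k → Matrix (Fin n) (Fin n) ℂ) :
    Matrix (Fin n) (Fin n) ℂ →ₗ[ℂ] Matrix (Fin n) (Fin n) ℂ where
  toFun X := ∑ i, A i * X * (A i)ᴴ
  map_add' X Y := by
    simp only [mul_add, add_mul, Finset.sum_add_distrib]
  map_smul' c X := by
    simp only [mul_smul_comm, smul_mul_assoc, Finset.smul_sum, RingHom.id_apply]

/-- The dual operator `X ↦ ∑ i, Aᵢ* X Aᵢ`. -/
def krausDual {n k : ℕ} (A : Fin k → Matrix (Fin n) (Fin n) ℂ) :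
    Matrix (Fin n) (Fin n) ℂ →ₗ[ℂ] Matrix (Fin n) (Fin n) ℂ where
  toFun X := ∑ i, (A i)ᴴ * X * A i
  map_add' X Y := by
    simp only [mul_add, add_mul, Finset.sum_add_distrib]
  map_smul' c X := by
    simp only [mul_smul_comm, smul_mul_assoc, Finset.smul_sum, RingHom.id_apply]

/-- `krausDual A` is the adjoint of `krausMap A` for the inner product `⟨X, Y⟩ = tr (X Y*)`;
so it depends on the operator `krausMap A` only, not on the chosen family `A`. -/
theorem trace_krausMap_mul {n k : ℕ} (A : Fin k → Matrix (Fin n) (Fin n) ℂ)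
    (X Y : Matrix (Fin n) (Fin n) ℂ) :
    (krausMap A X * Yᴴ).trace = (X * (krausDual A Y)ᴴ).trace := by
  simp only [krausMap, krausDual, LinearMap.coe_mk, AddHom.coe_mk, Finset.sum_mul,
    Matrix.conjTranspose_sum, Finset.mul_sum, Matrix.trace_sum, Matrix.conjTranspose_mul,
    Matrix.conjTranspose_conjTranspose]
  refine Finset.sum_congr rfl fun i _ => ?_
  rw [Matrix.mul_assoc, Matrix.mul_assoc, Matrix.trace_mul_comm]
  simp only [Matrix.mul_assoc]

/-- A quantum channel: a completely positive operator `X ↦ ∑ i, Aᵢ X Aᵢ*` with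
`∑ i, Aᵢ* Aᵢ = I`. -/
def IsQuantumChannel {n : ℕ}
    (Q : Matrix (Fin n) (Fin n) ℂ →ₗ[ℂ] Matrix (Fin n) (Fin n) ℂ) : Prop :=
  ∃ (k : ℕ) (A : Fin k → Matrix (Fin n) (Fin n) ℂ),
    Q = krausMap A ∧ ∑ i, (A i)ᴴ * A i = 1

/-- `Q` is positive: it maps every density matrix (positive semidefinite of trace one)
to a positive definite matrix. -/
def IsPositive {n : ℕ}
    (Q : Matrix (Fin n) (Fin n) ℂ →ₗ[ℂ] Matrix (Fin n) (Fin n) ℂ) : Prop :=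
  ∀ X : Matrix (Fin n) (Fin n) ℂ, X.PosSemidef → X.trace = 1 → (Q X).PosDef

/-- The scaling `X ↦ S Q(T X T*) S*` of `Q` by invertible matrices `S` and `T`. -/
def scaling {n : ℕ} (Q : Matrix (Fin n) (Fin n) ℂ →ₗ[ℂ] Matrix (Fin n) (Fin n) ℂ)
    (S T : GL (Fin n) ℂ) : Matrix (Fin n) (Fin n) ℂ →ₗ[ℂ] Matrix (Fin n) (Fin n) ℂ where
  toFun X := S.1 * Q (T.1 * X * T.1ᴴ) * S.1ᴴ
  map_add' X Y := by
    simp only [mul_add, add_mul, map_add]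
  map_smul' c X := by
    simp only [mul_smul_comm, smul_mul_assoc, map_smul, RingHom.id_apply]

/-- The Georgiou–Pavon equations for the operator `Q = krausMap A`, its dual `Q' = krausDual A`
and the matrices `ρ₀`, `ρT`, in the positive definite unknowns `φ₀, φT, φh₀, φhT` and the
arbitrary (not necessarily Hermitian) unknowns `χ₀, χT`. -/
structure GeorgiouPavon {n k : ℕ} (A : Fin k → Matrix (Fin n) (Fin n) ℂ)
    (ρ₀ ρT φ₀ φT φh₀ φhT χ₀ χT : Matrix (Fin n) (Fin n) ℂ) : Prop where
  posDef_φ₀ : φ₀.PosDef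
  posDef_φT : φT.PosDef
  posDef_φh₀ : φh₀.PosDef
  posDef_φhT : φhT.PosDef
  map_φT : krausMap A φT = φ₀
  dual_φh₀ : krausDual A φh₀ = φhT
  ρ₀_eq : ρ₀ = χ₀ * φh₀ * χ₀ᴴ
  ρT_eq : ρT = χT * φhT * χTᴴ
  φ₀_eq : φ₀ = χ₀ᴴ * χ₀
  φT_eq : φT = χTᴴ * χT

end QuantumBridge

end

/-! Existence is variational. Let `w` and `v` be the eigenvalues of `ρ₀` and `ρT`. Over upper
triangular `S`, `U`, maximise `diagWeight w S * diagWeight v U / tr (S Q(U*U) S*)`. The quotient is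
invariant under scaling `S` or `U`, and positivity of `Q` keeps the denominator away from zero on
the unit spheres, so compactness gives a maximiser (`exists_isUpperTriangular_maximizer`), and it is
invertible.

Because `diagWeight` is multiplicative on upper triangular matrices, replacing `S` by `B * S` turns
maximality into an inequality for `M = S Q(U*U) S*` alone. Elementary `B` kill the off-diagonal
entries of `M`; a diagonal `B` forces equality in weighted AM-GM, so `M` is a multiple of `diagonal
w`. By duality the same holds for `U Q'(S*S) U*` and `v`. After normalising
(`exists_scaling_to_diagonal`), unitary eigenbases of `ρ₀` and `ρT` turn `S`, `U` into a solution of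
the system.

The converse is algebra: `S*S = φh₀` and `T ρT T* = φT`. -/

namespace QuantumBridge

open Matrix

variable {n k : ℕ}

/-! ### Weighted products of diagonal entries -/

/-- The weighted product `∏ i, |Sᵢᵢ|^(2 wᵢ)` of the diagonal entries of `S`. -/
noncomputable def diagWeight (w : Fin n → ℝ) (S : Matrix (Fin n) (Fin n) ℂ) : ℝ :=
  ∏ i, (‖S i i‖ ^ 2) ^ w i

theorem diagWeight_nonneg (w : Fin n → ℝ) (S : Matrix (Fin n) (Fin n) ℂ) :
    0 ≤ diagWeight w S :=
  Finset.prod_nonneg fun _ _ => by positivity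

theorem continuous_diagWeight {w : Fin n → ℝ} (hw : ∀ i, 0 < w i) :
    Continuous (diagWeight w) := by
  unfold diagWeight
  refine continuous_finsetProd _ fun i _ => ?_
  refine Continuous.rpow_const (by fun_prop) fun _ => Or.inr (hw i).le

theorem mul_apply_diag {S B : Matrix (Fin n) (Fin n) ℂ} (hB : B.IsUpperTriangular)
    (hS : S.IsUpperTriangular) (i : Fin n) : (B * S) i i = B i i * S i i := by
  rw [Matrix.mul_apply]
  refine Finset.sum_eq_single i (fun j _ hj => ?_) (by simp)
  rcases lt_or_gt_of_ne hj with h | h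
  · rw [hB h, zero_mul]
  · rw [hS h, mul_zero]

theorem diagWeight_mul (w : Fin n → ℝ) {S B : Matrix (Fin n) (Fin n) ℂ}
    (hB : B.IsUpperTriangular) (hS : S.IsUpperTriangular) :
    diagWeight w (B * S) = diagWeight w B * diagWeight w S := by
  simp only [diagWeight, ← Finset.prod_mul_distrib, mul_apply_diag hB hS, norm_mul, mul_pow]
  refine Finset.prod_congr rfl fun i _ => Real.mul_rpow (by positivity) (by positivity)

/-- Total weight one gives degree two, matching the trace in the denominator of the quotient. -/
theorem diagWeight_smul {w : Fin n → ℝ} (hw : ∀ i, 0 < w i) (hw1 : ∑ i, w i = 1) (c : ℂ)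
    (S : Matrix (Fin n) (Fin n) ℂ) : diagWeight w (c • S) = ‖c‖ ^ 2 * diagWeight w S := by
  have : ∏ i, (‖c‖ ^ 2) ^ w i = ‖c‖ ^ 2 := by
    rw [← Real.rpow_sum_of_nonneg (by positivity) fun i _ => (hw i).le, hw1, Real.rpow_one]
  rw [diagWeight, diagWeight, ← this, ← Finset.prod_mul_distrib]
  refine Finset.prod_congr rfl fun i _ => ?_
  rw [Matrix.smul_apply, smul_eq_mul, norm_mul, mul_pow,
    Real.mul_rpow (by positivity) (by positivity)]

theorem diagWeight_one (w : Fin n → ℝ) : diagWeight w 1 = 1 := by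
  simp [diagWeight]

theorem isUnit_of_diagWeight_ne_zero {w : Fin n → ℝ} (hw : ∀ i, 0 < w i)
    {S : Matrix (Fin n) (Fin n) ℂ} (hS : S.IsUpperTriangular) (h : diagWeight w S ≠ 0) :
    IsUnit S := by
  rw [Matrix.isUnit_iff_isUnit_det, Matrix.det_of_isUpperTriangular hS, isUnit_iff_ne_zero,
    Finset.prod_ne_zero_iff]
  intro i _ hi
  refine h (Finset.prod_eq_zero (Finset.mem_univ i) ?_)
  simp [hi, Real.zero_rpow (hw i).ne']

/-! ### First-order conditions at an extremal triangular matrix -/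

/-- The off-diagonal part of the first-order condition. -/
theorem apply_eq_zero_of_diagWeight_mul_trace_le {w : Fin n → ℝ}
    {M : Matrix (Fin n) (Fin n) ℂ} (hM : M.IsHermitian)
    (h : ∀ B : Matrix (Fin n) (Fin n) ℂ, B.IsUpperTriangular →
      diagWeight w B * M.trace.re ≤ (B * M * Bᴴ).trace.re) {i j : Fin n} (hij : i < j) :
    M j i = 0 := by
  -- Testing with the transvection `1 + z E_ij`, which has weight one.
  have key : ∀ z : ℂ, 0 ≤ 2 * (z * M j i).re + ‖z‖ ^ 2 * (M j j).re := by
    intro z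
    have hB : (1 + Matrix.single i j z).IsUpperTriangular :=
      Matrix.blockTriangular_one.add (Matrix.blockTriangular_single hij.le z)
    have h1 : diagWeight w (1 + Matrix.single i j z) = 1 := by
      rw [← diagWeight_one w]
      refine Finset.prod_congr rfl fun l _ => ?_
      have : Matrix.single i j z l l = 0 := by
        rw [Matrix.single_apply_of_ne]
        rintro ⟨rfl, rfl⟩
        exact lt_irrefl _ hij
      rw [Matrix.add_apply, this, add_zero]
    have h2 : ((1 + Matrix.single i j z) * M * (1 + Matrix.single i j z)ᴴ).trace =
        M.trace + z * M j i + star (z * M j i) + z * star z * M j j := by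
      have hMij : M i j = star (M j i) := (hM.apply i j).symm
      rw [Matrix.conjTranspose_add, Matrix.conjTranspose_one, Matrix.conjTranspose_single,
        add_mul, mul_add, one_mul, mul_one, add_mul, Matrix.trace_add,
        Matrix.trace_add, Matrix.trace_add, Matrix.trace_single_mul, Matrix.trace_mul_single,
        Matrix.single_mul_mul_single, Matrix.trace_single_eq_same, hMij, star_mul',
        op_smul_eq_mul]
      simp only [smul_eq_mul]
      ring
    have h3 := h _ hB
    rw [h1, h2, one_mul] at h3
    have h4 : (z * star z * M j j).re = ‖z‖ ^ 2 * (M j j).re := by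
      rw [Complex.star_def, Complex.mul_conj, Complex.re_ofReal_mul, Complex.normSq_eq_norm_sq]
    rw [Complex.add_re, Complex.add_re, Complex.add_re, h4, Complex.star_def,
      Complex.conj_re] at h3
    linarith
  by_contra hne
  have hm : 0 < ‖M j i‖ ^ 2 := by positivity
  obtain ⟨t, ht0, ht⟩ : ∃ t : ℝ, 0 < t ∧ t * (M j j).re < 2 := by
    refine ⟨1 / (|(M j j).re| + 1), by positivity, ?_⟩
    rw [div_mul_eq_mul_div, div_lt_iff₀ (by positivity)]
    have := le_abs_self (M j j).re
    have := abs_nonneg (M j j).re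
    linarith
  -- At this `z` the quadratic equals `t |M_ji|² (t M_jj - 2)`, which is negative by the choice of
  -- `t`.
  have h5 := key (-(t : ℂ) * star (M j i))
  have h6 : (-(t : ℂ) * star (M j i) * M j i).re = -(t * ‖M j i‖ ^ 2) := by
    rw [mul_assoc, mul_comm (star _), Complex.star_def, Complex.mul_conj,
      Complex.normSq_eq_norm_sq, ← Complex.ofReal_neg, ← Complex.ofReal_mul, Complex.ofReal_re]
    ring
  have h7 : ‖-(t : ℂ) * star (M j i)‖ = t * ‖M j i‖ := by
    simp [abs_of_pos ht0]
  rw [h6, h7, mul_pow] at h5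
  have h8 : 0 ≤ (t * ‖M j i‖ ^ 2) * (t * (M j j).re - 2) := by linarith
  exact absurd h8 (not_le.mpr (mul_neg_of_pos_of_neg (by positivity) (by linarith)))

/-- The diagonal part of the first-order condition. -/
theorem diag_eq_of_diagWeight_mul_trace_le {w : Fin n → ℝ} (hw : ∀ i, 0 < w i)
    (hw1 : ∑ i, w i = 1) {M : Matrix (Fin n) (Fin n) ℂ} (hM : M.PosDef)
    (h : ∀ B : Matrix (Fin n) (Fin n) ℂ, B.IsUpperTriangular →
      diagWeight w B * M.trace.re ≤ (B * M * Bᴴ).trace.re) (i : Fin n) :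
    (M i i).re = w i * M.trace.re := by
  have hpos : ∀ i, 0 < (M i i).re := fun i => (Complex.pos_iff.mp (hM.diag_pos (i := i))).1
  have htr : M.trace.re = ∑ i, (M i i).re := by simp [Matrix.trace]
  -- This `B` makes `tr (B M B*) = ∑ w_i = 1`, so the hypothesis becomes `tr M ≤ ∏ (M_ii / w_i) ^
  -- w_i`: weighted AM-GM reversed, whose equality case makes all `M_ii / w_i` equal.
  have hB := h (Matrix.diagonal fun i => ((√(w i / (M i i).re) : ℝ) : ℂ))
    (Matrix.blockTriangular_diagonal _)
  have hsq : ∀ i, √(w i / (M i i).re) ^ 2 = w i / (M i i).re := fun i =>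
    Real.sq_sqrt (div_pos (hw i) (hpos i)).le
  have h1 : diagWeight w (Matrix.diagonal fun i => ((√(w i / (M i i).re) : ℝ) : ℂ)) =
      (∏ i, ((M i i).re / w i) ^ w i)⁻¹ := by
    rw [diagWeight, ← Finset.prod_inv_distrib]
    refine Finset.prod_congr rfl fun i _ => ?_
    rw [Matrix.diagonal_apply_eq, Complex.norm_real, Real.norm_eq_abs, sq_abs, hsq,
      ← Real.inv_rpow (div_pos (hpos i) (hw i)).le, inv_div]
  have h2 : ((Matrix.diagonal fun i => ((√(w i / (M i i).re) : ℝ) : ℂ)) * M *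
      (Matrix.diagonal fun i => ((√(w i / (M i i).re) : ℝ) : ℂ))ᴴ).trace.re = 1 := by
    rw [← hw1, Matrix.trace, Complex.re_sum]
    refine Finset.sum_congr rfl fun i _ => ?_
    rw [Matrix.diag_apply, Matrix.diagonal_conjTranspose, Matrix.mul_diagonal,
      Matrix.diagonal_mul, Pi.star_apply, Complex.star_def, Complex.conj_ofReal,
      Complex.re_mul_ofReal, Complex.re_ofReal_mul, mul_right_comm, ← sq, hsq,
      div_mul_cancel₀ _ (hpos i).ne']
  rw [h1, h2] at hB
  have hgpos : 0 < ∏ i, ((M i i).re / w i) ^ w i :=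
    Finset.prod_pos fun i _ => Real.rpow_pos_of_pos (div_pos (hpos i) (hw i)) _
  have hsum : ∑ i, w i * ((M i i).re / w i) = M.trace.re := by
    rw [htr]
    exact Finset.sum_congr rfl fun i _ => mul_div_cancel₀ _ (hw i).ne'
  have hz : ∀ i ∈ Finset.univ, 0 ≤ (M i i).re / w i := fun i _ => (div_pos (hpos i) (hw i)).le
  have hle := Real.geom_mean_le_arith_mean_weighted Finset.univ w (fun i => (M i i).re / w i)
    (fun i _ => (hw i).le) hw1 hz
  have heq := le_antisymm hle (by
    rw [hsum]
    rwa [inv_mul_le_iff₀ hgpos, mul_one] at hB)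
  have := (Real.geom_mean_eq_arith_mean_weighted_iff_of_pos' Finset.univ w
    (fun i => (M i i).re / w i) (fun i _ => hw i) hw1 hz).mp heq i (Finset.mem_univ i)
  rw [hsum, div_eq_iff (hw i).ne'] at this
  rw [this, mul_comm]

theorem eq_smul_diagonal_of_diagWeight_mul_trace_le {w : Fin n → ℝ} (hw : ∀ i, 0 < w i)
    (hw1 : ∑ i, w i = 1) {M : Matrix (Fin n) (Fin n) ℂ} (hM : M.PosDef)
    (h : ∀ B : Matrix (Fin n) (Fin n) ℂ, B.IsUpperTriangular →
      diagWeight w B * M.trace.re ≤ (B * M * Bᴴ).trace.re) :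
    M = (M.trace.re : ℂ) • Matrix.diagonal fun i => (w i : ℂ) := by
  ext i j
  rw [Matrix.smul_apply, smul_eq_mul]
  rcases lt_trichotomy i j with hij | rfl | hij
  · rw [Matrix.diagonal_apply_ne _ hij.ne, mul_zero, ← hM.isHermitian.apply,
      apply_eq_zero_of_diagWeight_mul_trace_le hM.isHermitian h hij, star_zero]
  · rw [Matrix.diagonal_apply_eq, ← Complex.ofReal_mul, mul_comm,
      ← diag_eq_of_diagWeight_mul_trace_le hw hw1 hM h i]
    exact (hM.isHermitian.coe_re_apply_self i).symm
  · rw [Matrix.diagonal_apply_ne _ hij.ne', mul_zero,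
      apply_eq_zero_of_diagWeight_mul_trace_le hM.isHermitian h hij]

/-- An upper triangular matrix minimising `tr (S H S*) / diagWeight w S` diagonalises `H`. -/
theorem mul_mul_conjTranspose_eq_smul_diagonal {w : Fin n → ℝ} (hw : ∀ i, 0 < w i)
    (hw1 : ∑ i, w i = 1) {H S : Matrix (Fin n) (Fin n) ℂ} (hH : H.PosDef)
    (hS : S.IsUpperTriangular) (hS0 : 0 < diagWeight w S)
    (h : ∀ S' : Matrix (Fin n) (Fin n) ℂ, S'.IsUpperTriangular →
      diagWeight w S' * (S * H * Sᴴ).trace.re ≤ diagWeight w S * (S' * H * S'ᴴ).trace.re) :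
    S * H * Sᴴ = ((S * H * Sᴴ).trace.re : ℂ) • Matrix.diagonal fun i => (w i : ℂ) := by
  have hu := isUnit_of_diagWeight_ne_zero hw hS hS0.ne'
  refine eq_smul_diagonal_of_diagWeight_mul_trace_le hw hw1
    ((Matrix.IsUnit.posDef_star_right_conjugate_iff hu).mpr hH) fun B hB => ?_
  -- Competitors `B * S` move the extremal point to the identity.
  have h1 := h (B * S) (hB.mul hS)
  rw [diagWeight_mul w hB hS, mul_comm (diagWeight w B), mul_assoc] at h1
  have h2 := le_of_mul_le_mul_left h1 hS0
  rwa [show B * S * H * (B * S)ᴴ = B * (S * H * Sᴴ) * Bᴴ by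
    simp only [Matrix.conjTranspose_mul, Matrix.mul_assoc]] at h2

/-! ### Positivity of the operator and its dual -/

theorem IsPositive.posDef_map {Q : Matrix (Fin n) (Fin n) ℂ →ₗ[ℂ] Matrix (Fin n) (Fin n) ℂ}
    (hQ : IsPositive Q) {X : Matrix (Fin n) (Fin n) ℂ} (hX : X.PosSemidef) (hX0 : X ≠ 0) :
    (Q X).PosDef := by
  have htr : 0 < X.trace :=
    lt_of_le_of_ne hX.trace_nonneg fun h => hX0 (hX.trace_eq_zero_iff.mp h.symm)
  have hinv : 0 < X.trace⁻¹ := inv_pos.mpr htr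
  have h := hQ (X.trace⁻¹ • X) (hX.smul hinv.le) (by
    rw [Matrix.trace_smul, smul_eq_mul, inv_mul_cancel₀ htr.ne'])
  have h2 := h.smul htr
  rwa [map_smul, smul_smul, mul_inv_cancel₀ htr.ne', one_smul] at h2

theorem posDef_krausMap_conjTranspose_mul_self {A : Fin k → Matrix (Fin n) (Fin n) ℂ}
    (hA : IsPositive (krausMap A)) {U : Matrix (Fin n) (Fin n) ℂ} (hU : U ≠ 0) :
    (krausMap A (Uᴴ * U)).PosDef :=
  hA.posDef_map (Matrix.posSemidef_conjTranspose_mul_self U)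
    (by rwa [Ne, Matrix.conjTranspose_mul_self_eq_zero])

theorem trace_mul_mul_conjTranspose_pos {P S : Matrix (Fin n) (Fin n) ℂ} (hP : P.PosDef)
    (hS : S ≠ 0) : 0 < (S * P * Sᴴ).trace := by
  have hpsd := hP.posSemidef.mul_mul_conjTranspose_same S
  refine lt_of_le_of_ne hpsd.trace_nonneg fun h => ?_
  have h0 := hpsd.trace_eq_zero_iff.mp h.symm
  -- The diagonal entry at a nonzero row of `S` is the quadratic form of `P` at the conjugate of
  -- that row.
  obtain ⟨i, hi⟩ : ∃ i, S i ≠ 0 := by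
    by_contra! hc
    exact hS (funext hc)
  have hpos := hP.dotProduct_mulVec_pos (x := star (S i)) (by simpa using hi)
  have hii : (S * P * Sᴴ) i i = star (star (S i)) ⬝ᵥ (P *ᵥ star (S i)) := by
    rw [star_star, Matrix.dotProduct_mulVec]
    rfl
  rw [← hii, h0] at hpos
  exact lt_irrefl _ hpos

/-- Adjointness: a single functional thus governs both the condition in `S` and the one in `U`. -/
theorem trace_mul_krausDual_mul (A : Fin k → Matrix (Fin n) (Fin n) ℂ)
    (S U : Matrix (Fin n) (Fin n) ℂ) :
    (U * krausDual A (Sᴴ * S) * Uᴴ).trace = (S * krausMap A (Uᴴ * U) * Sᴴ).trace := by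
  have hdual : (krausDual A (Sᴴ * S))ᴴ = krausDual A (Sᴴ * S) := by
    simp [krausDual, Matrix.conjTranspose_sum, Matrix.mul_assoc]
  have h := trace_krausMap_mul A (Uᴴ * U) (Sᴴ * S)
  rw [hdual, Matrix.conjTranspose_mul, Matrix.conjTranspose_conjTranspose] at h
  rw [Matrix.trace_mul_cycle, ← h, Matrix.trace_mul_cycle, Matrix.trace_mul_comm]

theorem posDef_krausDual_conjTranspose_mul_self {A : Fin k → Matrix (Fin n) (Fin n) ℂ}
    (hA : IsPositive (krausMap A)) {S : Matrix (Fin n) (Fin n) ℂ} (hS : S ≠ 0) :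
    (krausDual A (Sᴴ * S)).PosDef := by
  refine Matrix.PosDef.of_dotProduct_mulVec_pos ?_ fun v hv => ?_
  · simp [Matrix.IsHermitian, krausDual, Matrix.conjTranspose_sum, Matrix.mul_assoc]
  · have hn : 0 < n := by
      rcases Nat.eq_zero_or_pos n with rfl | h
      · exact absurd (Subsingleton.elim v 0) hv
      · exact h
    obtain ⟨l⟩ : Nonempty (Fin n) := ⟨⟨0, hn⟩⟩
    -- With `U = e_l v*`, the trace of `U Q'(S*S) U*` is the quadratic form of `Q'(S*S)` at `v`, so
    -- positivity passes from `Q` to its dual.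
    have hU : Matrix.vecMulVec (Pi.single l 1) (star v) ≠ (0 : Matrix (Fin n) (Fin n) ℂ) := by
      intro h
      refine hv (funext fun i => ?_)
      simpa [Matrix.vecMulVec_apply] using congrFun (congrFun h l) i
    have h := trace_mul_mul_conjTranspose_pos (posDef_krausMap_conjTranspose_mul_self hA hU) hS
    rw [← trace_mul_krausDual_mul] at h
    convert h using 1
    rw [Matrix.vecMulVec_mul, Matrix.conjTranspose_vecMulVec, Matrix.vecMulVec_mul_vecMulVec,
      star_star, Matrix.vecMulVec_smul, Matrix.trace_smul, Matrix.trace_vecMulVec, Matrix.dotProduct_mulVec]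
    simp

/-! ### The trace functional and its maximiser -/

/-- The trace of `S Q(U* U) S*` for `Q = krausMap A`. -/
noncomputable def krausTrace (A : Fin k → Matrix (Fin n) (Fin n) ℂ)
    (S U : Matrix (Fin n) (Fin n) ℂ) : ℝ :=
  (S * krausMap A (Uᴴ * U) * Sᴴ).trace.re

theorem krausTrace_pos {A : Fin k → Matrix (Fin n) (Fin n) ℂ}
    (hA : IsPositive (krausMap A)) {S U : Matrix (Fin n) (Fin n) ℂ} (hS : S ≠ 0) (hU : U ≠ 0) :
    0 < krausTrace A S U :=
  (Complex.pos_iff.mp (trace_mul_mul_conjTranspose_pos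
    (posDef_krausMap_conjTranspose_mul_self hA hU) hS)).1

theorem krausTrace_smul_smul (A : Fin k → Matrix (Fin n) (Fin n) ℂ) (c d : ℂ)
    (S U : Matrix (Fin n) (Fin n) ℂ) :
    krausTrace A (c • S) (d • U) = ‖c‖ ^ 2 * ‖d‖ ^ 2 * krausTrace A S U := by
  rw [krausTrace, krausTrace, ← Complex.re_ofReal_mul]
  congr 1
  simp only [Matrix.conjTranspose_smul, Matrix.smul_mul, Matrix.mul_smul, map_smul, smul_smul,
    Matrix.trace_smul, smul_eq_mul]
  push_cast
  rw [← Complex.mul_conj', ← Complex.mul_conj', Complex.star_def]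
  ring

theorem continuous_krausTrace (A : Fin k → Matrix (Fin n) (Fin n) ℂ) :
    Continuous fun p : Matrix (Fin n) (Fin n) ℂ × Matrix (Fin n) (Fin n) ℂ =>
      krausTrace A p.1 p.2 := by
  simp only [krausTrace, krausMap, LinearMap.coe_mk, AddHom.coe_mk]
  fun_prop

theorem isClosed_isUpperTriangular :
    IsClosed {S : Matrix (Fin n) (Fin n) ℂ | S.IsUpperTriangular} := by
  simp only [Matrix.IsUpperTriangular, Matrix.BlockTriangular, Set.ofPred_forall]
  refine isClosed_iInter fun i => isClosed_iInter fun j => isClosed_iInter fun _ => ?_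
  exact isClosed_eq (by fun_prop) continuous_const

open scoped Matrix.Norms.Elementwise in
/-- The quotient `diagWeight w S * diagWeight v U / krausTrace A S U` attains its maximum over
upper triangular matrices. -/
theorem exists_isUpperTriangular_maximizer [NeZero n] {A : Fin k → Matrix (Fin n) (Fin n) ℂ}
    (hA : IsPositive (krausMap A)) {w v : Fin n → ℝ} (hw : ∀ i, 0 < w i) (hw1 : ∑ i, w i = 1)
    (hv : ∀ i, 0 < v i) (hv1 : ∑ i, v i = 1) :
    ∃ S U : Matrix (Fin n) (Fin n) ℂ, S.IsUpperTriangular ∧ U.IsUpperTriangular ∧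
      0 < diagWeight w S ∧ 0 < diagWeight v U ∧
      ∀ S' U' : Matrix (Fin n) (Fin n) ℂ, S'.IsUpperTriangular → U'.IsUpperTriangular →
        diagWeight w S' * diagWeight v U' * krausTrace A S U ≤
          diagWeight w S * diagWeight v U * krausTrace A S' U' := by
  let K : Set (Matrix (Fin n) (Fin n) ℂ × Matrix (Fin n) (Fin n) ℂ) :=
    (Metric.sphere 0 1 ∩ {S | S.IsUpperTriangular}) ×ˢ
      (Metric.sphere 0 1 ∩ {S | S.IsUpperTriangular})
  have hprop : ProperSpace (Matrix (Fin n) (Fin n) ℂ) := FiniteDimensional.proper ℂ _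
  have hK1 : IsCompact (Metric.sphere (0 : Matrix (Fin n) (Fin n) ℂ) 1 ∩
      {S | S.IsUpperTriangular}) :=
    (isCompact_sphere _ _).inter_right isClosed_isUpperTriangular
  have hK : IsCompact K := hK1.prod hK1
  have hne : ∀ S : Matrix (Fin n) (Fin n) ℂ, ‖S‖ = 1 → S ≠ 0 := by
    rintro S hS rfl
    simp at hS
  have hpos : ∀ p ∈ K, 0 < krausTrace A p.1 p.2 := fun p hp =>
    krausTrace_pos hA (hne _ (by simpa using hp.1.1)) (hne _ (by simpa using hp.2.1))
  have hcont : ContinuousOn (fun p : Matrix (Fin n) (Fin n) ℂ × Matrix (Fin n) (Fin n) ℂ =>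
      diagWeight w p.1 * diagWeight v p.2 / krausTrace A p.1 p.2) K :=
    ContinuousOn.div
      (((continuous_diagWeight hw).comp continuous_fst).mul
        ((continuous_diagWeight hv).comp continuous_snd)).continuousOn
      (continuous_krausTrace A).continuousOn fun p hp => (hpos p hp).ne'
  have hnorm : ∀ S : Matrix (Fin n) (Fin n) ℂ, S ≠ 0 → S.IsUpperTriangular →
      (((‖S‖⁻¹ : ℝ) : ℂ) • S) ∈ Metric.sphere (0 : Matrix (Fin n) (Fin n) ℂ) 1 ∩
        {S | S.IsUpperTriangular} := by
    intro S hS hSt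
    refine ⟨?_, fun i j hij => ?_⟩
    · rw [mem_sphere_zero_iff_norm, norm_smul, Complex.norm_real, norm_inv, norm_norm,
        inv_mul_cancel₀ (norm_ne_zero_iff.mpr hS)]
    · rw [Matrix.smul_apply, hSt hij, smul_zero]
  have hc : ∀ S : Matrix (Fin n) (Fin n) ℂ, S ≠ 0 → 0 < ‖((‖S‖⁻¹ : ℝ) : ℂ)‖ ^ 2 := by
    intro S hS
    rw [Complex.norm_real]
    exact pow_pos (norm_pos_iff.mpr (inv_ne_zero (norm_ne_zero_iff.mpr hS))) 2
  have h1K := hnorm 1 one_ne_zero Matrix.blockTriangular_one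
  obtain ⟨⟨S, U⟩, hSU, hmax⟩ := hK.exists_isMaxOn ⟨(_, _), h1K, h1K⟩ hcont
  have hN := hpos _ hSU
  have hmax' : ∀ p ∈ K, diagWeight w p.1 * diagWeight v p.2 * krausTrace A S U ≤
      diagWeight w S * diagWeight v U * krausTrace A p.1 p.2 := fun p hp =>
    (div_le_div_iff₀ (hpos p hp) hN).mp (hmax hp)
  -- Comparison with the normalised identity shows that the maximum is positive, hence the maximiser
  -- is nonsingular.
  have hd : 0 < diagWeight w S * diagWeight v U := by
    have hle := hmax' (_, _) ⟨h1K, h1K⟩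
    have hc1 := hc 1 one_ne_zero
    simp only [diagWeight_smul hw hw1, diagWeight_smul hv hv1, diagWeight_one, mul_one] at hle
    exact pos_of_mul_pos_left ((mul_pos (mul_pos hc1 hc1) hN).trans_le hle)
      (hpos (_, _) ⟨h1K, h1K⟩).le
  refine ⟨S, U, hSU.1.2, hSU.2.2, (diagWeight_nonneg w S).lt_of_ne' (left_ne_zero_of_mul hd.ne'),
    (diagWeight_nonneg v U).lt_of_ne' (right_ne_zero_of_mul hd.ne'), fun S' U' hS' hU' => ?_⟩
  have hzero : ∀ {u : Fin n → ℝ}, (∀ i, 0 < u i) → ∑ i, u i = 1 →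
      diagWeight u (0 : Matrix (Fin n) (Fin n) ℂ) = 0 := fun hu hu1 => by
    simpa using diagWeight_smul hu hu1 0 0
  by_cases hS0 : S' = 0
  · simp [hS0, hzero hw hw1, krausTrace]
  by_cases hU0 : U' = 0
  · simp [hU0, hzero hv hv1, krausTrace]
  have h := hmax' (_, _) ⟨hnorm S' hS0 hS', hnorm U' hU0 hU'⟩
  simp only [diagWeight_smul hw hw1, diagWeight_smul hv hv1, krausTrace_smul_smul] at h
  refine le_of_mul_le_mul_left (le_of_eq_of_le ?_ (h.trans_eq ?_))
    (mul_pos (hc S' hS0) (hc U' hU0)) <;> ring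

/-! ### Scaling to prescribed marginals -/

/-- A positive operator can be scaled by upper triangular matrices so that both of its marginals
are prescribed diagonal matrices. -/
theorem exists_scaling_to_diagonal [NeZero n] {A : Fin k → Matrix (Fin n) (Fin n) ℂ}
    (hA : IsPositive (krausMap A)) {w v : Fin n → ℝ} (hw : ∀ i, 0 < w i) (hw1 : ∑ i, w i = 1)
    (hv : ∀ i, 0 < v i) (hv1 : ∑ i, v i = 1) :
    ∃ S U : Matrix (Fin n) (Fin n) ℂ, IsUnit S ∧ IsUnit U ∧
      S * krausMap A (Uᴴ * U) * Sᴴ = Matrix.diagonal (fun i => (w i : ℂ)) ∧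
      U * krausDual A (Sᴴ * S) * Uᴴ = Matrix.diagonal (fun i => (v i : ℂ)) := by
  obtain ⟨S, U, hS, hU, hS0, hU0, hmax⟩ :=
    exists_isUpperTriangular_maximizer hA hw hw1 hv hv1
  have hSu := isUnit_of_diagWeight_ne_zero hw hS hS0.ne'
  have hUu := isUnit_of_diagWeight_ne_zero hv hU hU0.ne'
  have h1 := mul_mul_conjTranspose_eq_smul_diagonal hw hw1
    (posDef_krausMap_conjTranspose_mul_self hA hUu.ne_zero) hS hS0 fun S' hS' => by
      have h := hmax S' U hS' hU
      rw [mul_right_comm, mul_right_comm (diagWeight w S)] at h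
      exact le_of_mul_le_mul_right h hU0
  have h2 := mul_mul_conjTranspose_eq_smul_diagonal hv hv1
    (posDef_krausDual_conjTranspose_mul_self hA hSu.ne_zero) hU hU0 fun U' hU' => by
      have h := hmax S U' hS hU'
      rw [mul_assoc, mul_assoc] at h
      rw [trace_mul_krausDual_mul, trace_mul_krausDual_mul]
      exact le_of_mul_le_mul_left h hS0
  rw [trace_mul_krausDual_mul] at h2
  have hN : 0 < krausTrace A S U := krausTrace_pos hA hSu.ne_zero hUu.ne_zero
  change _ = (krausTrace A S U : ℂ) • _ at h1
  change _ = (krausTrace A S U : ℂ) • _ at h2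
  set N := krausTrace A S U
  have hr : star ((√N⁻¹ : ℝ) : ℂ) = ((√N⁻¹ : ℝ) : ℂ) := Complex.conj_ofReal _
  have hrr : ((√N⁻¹ : ℝ) : ℂ) * ((√N⁻¹ : ℝ) : ℂ) * (N : ℂ) = 1 := by
    rw [← Complex.ofReal_mul, Real.mul_self_sqrt (inv_pos.mpr hN).le, ← Complex.ofReal_mul,
      inv_mul_cancel₀ hN.ne', Complex.ofReal_one]
  have hr0 : ((√N⁻¹ : ℝ) : ℂ) ≠ 0 := by
    intro h
    rw [h, zero_mul, zero_mul] at hrr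
    exact zero_ne_one hrr
  -- Both marginals have the same trace `N` and are quadratic in `S`, so rescaling `S` alone
  -- normalises both.
  refine ⟨((√N⁻¹ : ℝ) : ℂ) • S, U, ?_, hUu, ?_, ?_⟩
  · simpa using hSu.smul (Units.mk0 _ hr0)
  · rw [Matrix.conjTranspose_smul, hr, Matrix.smul_mul, Matrix.smul_mul, Matrix.mul_smul, h1,
      smul_smul, smul_smul, hrr, one_smul]
  · rw [Matrix.conjTranspose_smul, hr, Matrix.smul_mul, Matrix.mul_smul, smul_smul, map_smul,
      Matrix.mul_smul, Matrix.smul_mul, h2, smul_smul, hrr, one_smul]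

/-! ### Solving the system -/

theorem exists_unitary_diagonalization {ρ : Matrix (Fin n) (Fin n) ℂ} (hρ : ρ.PosDef)
    (hρ1 : ρ.trace = 1) :
    ∃ (V : Matrix (Fin n) (Fin n) ℂ) (w : Fin n → ℝ), Vᴴ * V = 1 ∧ (∀ i, 0 < w i) ∧
      ∑ i, w i = 1 ∧ ρ = V * Matrix.diagonal (fun i => (w i : ℂ)) * Vᴴ := by
  refine ⟨hρ.1.eigenvectorUnitary, hρ.1.eigenvalues, ?_, hρ.eigenvalues_pos, ?_, ?_⟩
  · exact Unitary.coe_star_mul_self _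
  · have h := hρ.1.trace_eq_sum_eigenvalues
    rw [hρ1] at h
    apply Complex.ofReal_injective
    rw [Complex.ofReal_sum, Complex.ofReal_one]
    exact h.symm
  · have h := hρ.1.spectral_theorem
    rwa [Unitary.conjStarAlgAut_apply] at h

theorem exists_georgiouPavon {A : Fin k → Matrix (Fin n) (Fin n) ℂ}
    (hA : IsPositive (krausMap A)) {ρ₀ ρT : Matrix (Fin n) (Fin n) ℂ}
    (hρ₀ : ρ₀.PosDef) (hρ₀_trace : ρ₀.trace = 1) (hρT : ρT.PosDef) (hρT_trace : ρT.trace = 1) :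
    ∃ φ₀ φT φh₀ φhT χ₀ χT : Matrix (Fin n) (Fin n) ℂ,
      GeorgiouPavon A ρ₀ ρT φ₀ φT φh₀ φhT χ₀ χT := by
  have hn : NeZero n := ⟨by
    rintro rfl
    simp [Matrix.trace] at hρ₀_trace⟩
  obtain ⟨V, w, hV, hw, hw1, rfl⟩ := exists_unitary_diagonalization hρ₀ hρ₀_trace
  obtain ⟨W, v, hW, hv, hv1, rfl⟩ := exists_unitary_diagonalization hρT hρT_trace
  obtain ⟨S, U, hS, hU, h1, h2⟩ := exists_scaling_to_diagonal hA hw hw1 hv hv1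
  have hSd : IsUnit S.det := (Matrix.isUnit_iff_isUnit_det S).mp hS
  have hSHd : IsUnit Sᴴ.det := (Matrix.isUnit_iff_isUnit_det Sᴴ).mp hS.star
  set D : Matrix (Fin n) (Fin n) ℂ := Matrix.diagonal fun i => ((√(w i) : ℝ) : ℂ) with hD
  have hDH : Dᴴ = D := by
    rw [hD, Matrix.diagonal_conjTranspose]
    congr 1
    ext i
    exact Complex.conj_ofReal _
  have hDD : D * D = Matrix.diagonal fun i => (w i : ℂ) := by
    rw [hD, Matrix.diagonal_mul_diagonal]
    congr 1
    ext i
    rw [← Complex.ofReal_mul, Real.mul_self_sqrt (hw i).le]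
  have posDef_of_isUnit {X : Matrix (Fin n) (Fin n) ℂ} (hX : IsUnit X) : (Xᴴ * X).PosDef :=
    Matrix.PosDef.conjTranspose_mul_self X (Matrix.mulVec_injective_iff_isUnit.mpr hX)
  -- The factor `V D` satisfies `(V D)* (V D) = diagonal w` and `(V D)(V D)* = ρ₀`; hence `χ₀ = V D
  -- (S*)⁻¹` meets both equations involving it.
  refine ⟨krausMap A (Uᴴ * U), Uᴴ * U, Sᴴ * S, krausDual A (Sᴴ * S), V * D * (Sᴴ)⁻¹, W * U,
    posDef_krausMap_conjTranspose_mul_self hA hU.ne_zero, posDef_of_isUnit hU,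
    posDef_of_isUnit hS, posDef_krausDual_conjTranspose_mul_self hA hS.ne_zero, rfl, rfl,
    ?_, ?_, ?_, ?_⟩
  · have h3 : (V * D * (Sᴴ)⁻¹)ᴴ = S⁻¹ * (D * Vᴴ) := by
      rw [Matrix.conjTranspose_mul, Matrix.conjTranspose_mul, hDH,
        Matrix.conjTranspose_nonsing_inv, Matrix.conjTranspose_conjTranspose]
    calc V * Matrix.diagonal (fun i => (w i : ℂ)) * Vᴴ
        = V * D * ((Sᴴ)⁻¹ * Sᴴ) * (S * S⁻¹) * (D * Vᴴ) := by
          rw [Matrix.nonsing_inv_mul _ hSHd, Matrix.mul_nonsing_inv _ hSd, ← hDD]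
          simp only [Matrix.mul_one, Matrix.mul_assoc]
      _ = V * D * (Sᴴ)⁻¹ * (Sᴴ * S) * (V * D * (Sᴴ)⁻¹)ᴴ := by
          rw [h3]
          simp only [Matrix.mul_assoc]
  · rw [Matrix.conjTranspose_mul, ← h2]
    simp only [Matrix.mul_assoc]
  · have h3 : (V * D * (Sᴴ)⁻¹)ᴴ = S⁻¹ * (D * Vᴴ) := by
      rw [Matrix.conjTranspose_mul, Matrix.conjTranspose_mul, hDH,
        Matrix.conjTranspose_nonsing_inv, Matrix.conjTranspose_conjTranspose]
    calc krausMap A (Uᴴ * U)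
        = S⁻¹ * S * krausMap A (Uᴴ * U) * (Sᴴ * (Sᴴ)⁻¹) := by
          rw [Matrix.nonsing_inv_mul _ hSd, Matrix.mul_nonsing_inv _ hSHd, Matrix.one_mul,
            Matrix.mul_one]
      _ = S⁻¹ * (S * krausMap A (Uᴴ * U) * Sᴴ) * (Sᴴ)⁻¹ := by
          simp only [Matrix.mul_assoc]
      _ = S⁻¹ * (D * (Vᴴ * V) * D) * (Sᴴ)⁻¹ := by
          rw [h1, hV, Matrix.mul_one, hDD]
      _ = (V * D * (Sᴴ)⁻¹)ᴴ * (V * D * (Sᴴ)⁻¹) := by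
          rw [h3]
          simp only [Matrix.mul_assoc]
  · calc Uᴴ * U = Uᴴ * (Wᴴ * W) * U := by rw [hW, Matrix.mul_one]
      _ = (W * U)ᴴ * (W * U) := by
          rw [Matrix.conjTranspose_mul]
          simp only [Matrix.mul_assoc]

/-! ### From solutions to quantum channels -/

theorem scaling_krausMap (A : Fin k → Matrix (Fin n) (Fin n) ℂ) (S T : GL (Fin n) ℂ) :
    scaling (krausMap A) S T = krausMap fun i => S.1 * A i * T.1 := by
  ext1 X
  simp [scaling, krausMap, Finset.mul_sum, Finset.sum_mul, Matrix.mul_assoc]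

/-- Since `S*S = φh₀`, the Kraus sum of the scaling is `T* φhT T = ρT^(-1/2) ρT ρT^(-1/2) = 1`.
Since `T ρT T* = φT`, the image of `ρT` is `S φ₀ S* = ρ₀`. -/
theorem GeorgiouPavon.exists_scaling {A : Fin k → Matrix (Fin n) (Fin n) ℂ}
    {ρ₀ ρT φ₀ φT φh₀ φhT χ₀ χT : Matrix (Fin n) (Fin n) ℂ} (hρ₀ : ρ₀.PosDef) (hρT : ρT.PosDef)
    (h : GeorgiouPavon A ρ₀ ρT φ₀ φT φh₀ φhT χ₀ χT) :
    IsUnit χ₀ ∧ IsUnit χT ∧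
      ∃ S T : GL (Fin n) ℂ,
        (S : Matrix (Fin n) (Fin n) ℂ) = CFC.sqrt ρ₀ * (χ₀ᴴ)⁻¹ ∧
        (T : Matrix (Fin n) (Fin n) ℂ) = χTᴴ * (CFC.sqrt ρT)⁻¹ ∧
        IsQuantumChannel (scaling (krausMap A) S T) ∧
        scaling (krausMap A) S T ρT = ρ₀ := by
  have isUnit_of_posDef {X : Matrix (Fin n) (Fin n) ℂ} (hX : (Xᴴ * X).PosDef) : IsUnit X := by
    have h := hX.isUnit
    rw [Matrix.isUnit_iff_isUnit_det, Matrix.det_mul] at h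
    exact (Matrix.isUnit_iff_isUnit_det X).mpr (isUnit_of_mul_isUnit_right h)
  have hχ₀ := isUnit_of_posDef (h.φ₀_eq ▸ h.posDef_φ₀)
  have hχT := isUnit_of_posDef (h.φT_eq ▸ h.posDef_φT)
  have sqrt_mul {ρ : Matrix (Fin n) (Fin n) ℂ} (hρ : ρ.PosDef) :
      CFC.sqrt ρ * CFC.sqrt ρ = ρ :=
    CFC.sqrt_mul_sqrt_self ρ (Matrix.nonneg_iff_posSemidef.mpr hρ.posSemidef)
  have sqrt_star (ρ : Matrix (Fin n) (Fin n) ℂ) : (CFC.sqrt ρ)ᴴ = CFC.sqrt ρ :=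
    (Matrix.nonneg_iff_posSemidef.mp (CFC.sqrt_nonneg ρ)).isHermitian
  have sqrt_isUnit {ρ : Matrix (Fin n) (Fin n) ℂ} (hρ : ρ.PosDef) : IsUnit (CFC.sqrt ρ) := by
    refine isUnit_of_posDef ?_
    rw [sqrt_star, sqrt_mul hρ]
    exact hρ
  have hS : IsUnit (CFC.sqrt ρ₀ * (χ₀ᴴ)⁻¹) :=
    (sqrt_isUnit hρ₀).mul (Matrix.isUnit_nonsing_inv_iff.mpr hχ₀.star)
  have hT : IsUnit (χTᴴ * (CFC.sqrt ρT)⁻¹) :=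
    hχT.star.mul (Matrix.isUnit_nonsing_inv_iff.mpr (sqrt_isUnit hρT))
  have hχ₀d := (Matrix.isUnit_iff_isUnit_det _).mp hχ₀
  have hχ₀Hd : IsUnit χ₀ᴴ.det := (Matrix.isUnit_iff_isUnit_det _).mp hχ₀.star
  have hRd := (Matrix.isUnit_iff_isUnit_det _).mp (sqrt_isUnit hρT)
  have hSH : (CFC.sqrt ρ₀ * (χ₀ᴴ)⁻¹)ᴴ = χ₀⁻¹ * CFC.sqrt ρ₀ := by
    rw [Matrix.conjTranspose_mul, sqrt_star, Matrix.conjTranspose_nonsing_inv,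
      Matrix.conjTranspose_conjTranspose]
  have hTH : (χTᴴ * (CFC.sqrt ρT)⁻¹)ᴴ = (CFC.sqrt ρT)⁻¹ * χT := by
    rw [Matrix.conjTranspose_mul, Matrix.conjTranspose_nonsing_inv, sqrt_star,
      Matrix.conjTranspose_conjTranspose]
  have hSS : (CFC.sqrt ρ₀ * (χ₀ᴴ)⁻¹)ᴴ * (CFC.sqrt ρ₀ * (χ₀ᴴ)⁻¹) = φh₀ := by
    calc (CFC.sqrt ρ₀ * (χ₀ᴴ)⁻¹)ᴴ * (CFC.sqrt ρ₀ * (χ₀ᴴ)⁻¹)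
        = χ₀⁻¹ * (CFC.sqrt ρ₀ * CFC.sqrt ρ₀) * (χ₀ᴴ)⁻¹ := by
          rw [hSH]
          simp only [Matrix.mul_assoc]
      _ = χ₀⁻¹ * (χ₀ * φh₀ * χ₀ᴴ) * (χ₀ᴴ)⁻¹ := by rw [sqrt_mul hρ₀, ← h.ρ₀_eq]
      _ = (χ₀⁻¹ * χ₀) * φh₀ * (χ₀ᴴ * (χ₀ᴴ)⁻¹) := by simp only [Matrix.mul_assoc]
      _ = φh₀ := by
          rw [Matrix.nonsing_inv_mul _ hχ₀d, Matrix.mul_nonsing_inv _ hχ₀Hd, Matrix.one_mul,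
            Matrix.mul_one]
  refine ⟨hχ₀, hχT, hS.unit, hT.unit, rfl, rfl, ⟨k, _, scaling_krausMap A _ _, ?_⟩, ?_⟩
  · calc ∑ i, (hS.unit.1 * A i * hT.unit.1)ᴴ * (hS.unit.1 * A i * hT.unit.1)
        = hT.unit.1ᴴ * krausDual A (hS.unit.1ᴴ * hS.unit.1) * hT.unit.1 := by
          simp [krausDual, Finset.mul_sum, Finset.sum_mul, Matrix.mul_assoc]
      _ = (CFC.sqrt ρT)⁻¹ * (χT * φhT * χTᴴ) * (CFC.sqrt ρT)⁻¹ := by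
          rw [IsUnit.unit_spec, IsUnit.unit_spec, hSS, h.dual_φh₀, hTH]
          simp only [Matrix.mul_assoc]
      _ = ((CFC.sqrt ρT)⁻¹ * CFC.sqrt ρT) * (CFC.sqrt ρT * (CFC.sqrt ρT)⁻¹) := by
          rw [← h.ρT_eq, ← Matrix.mul_assoc, Matrix.mul_assoc _ (CFC.sqrt ρT) (CFC.sqrt ρT),
            sqrt_mul hρT]
      _ = 1 := by
          rw [Matrix.nonsing_inv_mul _ hRd, Matrix.mul_nonsing_inv _ hRd, Matrix.one_mul]
  · have hTT : χTᴴ * (CFC.sqrt ρT)⁻¹ * ρT * (χTᴴ * (CFC.sqrt ρT)⁻¹)ᴴ = φT := by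
      calc χTᴴ * (CFC.sqrt ρT)⁻¹ * ρT * (χTᴴ * (CFC.sqrt ρT)⁻¹)ᴴ
          = χTᴴ * (CFC.sqrt ρT)⁻¹ * (CFC.sqrt ρT * CFC.sqrt ρT) *
              ((CFC.sqrt ρT)⁻¹ * χT) := by rw [hTH, sqrt_mul hρT]
        _ = χTᴴ * ((CFC.sqrt ρT)⁻¹ * CFC.sqrt ρT) * (CFC.sqrt ρT * (CFC.sqrt ρT)⁻¹) * χT := by
            simp only [Matrix.mul_assoc]
        _ = φT := by
            rw [Matrix.nonsing_inv_mul _ hRd, Matrix.mul_nonsing_inv _ hRd, Matrix.mul_one,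
              Matrix.mul_one, h.φT_eq]
    change CFC.sqrt ρ₀ * (χ₀ᴴ)⁻¹ * krausMap A
      (χTᴴ * (CFC.sqrt ρT)⁻¹ * ρT * (χTᴴ * (CFC.sqrt ρT)⁻¹)ᴴ) * (CFC.sqrt ρ₀ * (χ₀ᴴ)⁻¹)ᴴ = ρ₀
    calc _ = CFC.sqrt ρ₀ * ((χ₀ᴴ)⁻¹ * χ₀ᴴ) * (χ₀ * χ₀⁻¹) * CFC.sqrt ρ₀ := by
          rw [hTT, h.map_φT, h.φ₀_eq, hSH]
          simp only [Matrix.mul_assoc]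
      _ = ρ₀ := by
          rw [Matrix.nonsing_inv_mul _ hχ₀Hd, Matrix.mul_nonsing_inv _ hχ₀d, Matrix.mul_one,
            Matrix.mul_one, sqrt_mul hρ₀]

end QuantumBridge

theorem mainTheorem3 {n k : ℕ} (A : Fin k → Matrix (Fin n) (Fin n) ℂ)
    (hchannel : QuantumBridge.IsQuantumChannel (QuantumBridge.krausMap A))
    (hpos : QuantumBridge.IsPositive (QuantumBridge.krausMap A))
    (ρ₀ ρT : Matrix (Fin n) (Fin n) ℂ)
    (hρ₀ : ρ₀.PosDef) (hρ₀_trace : ρ₀.trace = 1)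
    (hρT : ρT.PosDef) (hρT_trace : ρT.trace = 1) :
    (∃ φ₀ φT φh₀ φhT χ₀ χT : Matrix (Fin n) (Fin n) ℂ,
      QuantumBridge.GeorgiouPavon A ρ₀ ρT φ₀ φT φh₀ φhT χ₀ χT) ∧
    (∀ φ₀ φT φh₀ φhT χ₀ χT : Matrix (Fin n) (Fin n) ℂ,
      QuantumBridge.GeorgiouPavon A ρ₀ ρT φ₀ φT φh₀ φhT χ₀ χT →
      IsUnit χ₀ ∧ IsUnit χT ∧
      ∃ S T : GL (Fin n) ℂ,
        (S : Matrix (Fin n) (Fin n) ℂ) = CFC.sqrt ρ₀ * (χ₀ᴴ)⁻¹ ∧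
        (T : Matrix (Fin n) (Fin n) ℂ) = χTᴴ * (CFC.sqrt ρT)⁻¹ ∧
        QuantumBridge.IsQuantumChannel
          (QuantumBridge.scaling (QuantumBridge.krausMap A) S T) ∧
        QuantumBridge.scaling (QuantumBridge.krausMap A) S T ρT = ρ₀) :=
  ⟨QuantumBridge.exists_georgiouPavon hpos hρ₀ hρ₀_trace hρT hρT_trace,
    fun _ _ _ _ _ _ h => h.exists_scaling hρ₀ hρT⟩
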